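/- Let $q$ be an odd prime power, $m\ge 1$ an integer, $\lambda$ a positive integer with $\lambda\mid q-1$, and $a_1:=\lambda(q+1)$. Let $A_1\subseteq\mathbb F_{q^2}$ be the set of roots of $X^{\lambda(q+1)}-1$, and for $j=2,\dots,m$ let $A_j\subseteq\mathbb F_{q^2}\setminus\{0\}$ be an arbitrary subset with $a_j:=\#A_j\ge 2$ (so $2\le a_j\le q^2-1$). Put $n:=a_1a_2\cdots a_m$ and $$E:=\{0,\dots,a_1-1\}\times\cdots\times\{0,\dots,a_m-1\},\qquad E_0:=\{\boldsymbol e\in E\mid e_1\le \tfrac{q-1}{2}\}.$$ Let $\zeta_t$ denote a primitive $t$-th root of unity in $\mathbb F_{q^2}$, choose an enumeration $A_j=\{\xi_{(j,0)},\dots,\xi_{(j,a_j-1)}\}$ for each $j\ge 2$, and for $\boldsymbol\alpha\in E$ let $$\boldsymbol P_{\boldsymbol\alpha}:=(\zeta_{\lambda(q+1)}^{\alpha_1},\xi_{(2,\alpha_2)},\dots,\xi_{(m,\alpha_m)})\in A_1\times\cdots\times A_m.$$ For $\boldsymbol w\in(\mathbb F_{q^2}\setminus\{0\})^n$, with coordinates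 indexed by $E$ (in lexicographic order), and $\Delta\subseteq E$, define the generalized monomial-Cartesian code $$C_{\boldsymbol w,\Delta}:=\{(w_{\boldsymbol\alpha}f(\boldsymbol P_{\boldsymbol\alpha}))_{\boldsymbol\alpha\in E}\mid f\in\operatorname{span}_{\mathbb F_{q^2}}\{X_1^{e_1}\cdots X_m^{e_m}\mid\boldsymbol e\in\Delta\}\}\subseteq\mathbb F_{q^2}^n.$$ Let $\boldsymbol v$ be the twist vector that consists of $q+1$ consecutive blocks of length $n/(q+1)$, alternately constant equal to $\zeta_{q^2-1}^{(q-1)/2}$ and to $1$, starting with $\zeta_{q^2-1}^{(q-1)/2}$; that is, $v_{\boldsymbol\alpha}=\zeta_{q^2-1}^{(q-1)/2}$ if $\lfloor\alpha_1/\lambda\rfloor$ is even and $v_{\boldsymbol\alpha}=1$ if it is odd. For a code $C\subseteq\mathbb F_{q^2}^n$ let $C^{\perp_h}$ and $C^{\perp_e}$ be its duals for the Hermitian product $\sum_i x_iy_i^q$ and the Euclidean product $\sum_i x_iy_i$. Then for every $\Delta\subseteq E_0$, $$C_{\boldsymbol v,\Delta}\subseteq (C_{\boldsymbol v,\Delta})^{\perp_h}.$$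 Moreover $2\,\#\Delta\le n$, and there exists a stabilizer quantum code with parameters $$[[n,\;n-2\,\#\Delta,\;\ge d]]_q,$$ where $d$ is the minimum distance of $(C_{\boldsymbol 1,\Delta})^{\perp_e}$ and $\boldsymbol 1$ is the all-ones vector. Here a stabilizer code is a nonzero subspace $Q\subseteq\mathbb C^{q^n}$ consisting of all vectors fixed by some abelian subgroup of the error group $G_n=\{\omega^cX(\boldsymbol a)Z(\boldsymbol b)\mid c\in\mathbb F_p,\ \boldsymbol a,\boldsymbol b\in\mathbb F_q^n\}$, where $p$ is the characteristic of $\mathbb F_q$, $\omega=e^{2\pi i/p}$, $X(\boldsymbol a)|\boldsymbol y\rangle=|\boldsymbol y+\boldsymbol a\rangle$ and $Z(\boldsymbol b)|\boldsymbol y\rangle=\omega^{\operatorname{tr}(\boldsymbol b\cdot\boldsymbol y)}|\boldsymbol y\rangle$. The weight of $\omega^cX(\boldsymbol a)Z(\boldsymbol b)$ is the number of $i$ with $(a_i,b_i)\ne(0,0)$. The code has parameters $[[n,k,D]]_q$ if $\dim Q=q^k$ and $D$ is its minimum distance, i.e. the least weight of an error $T\in G_n$ with $PTP\notin\mathbb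 CP$, where $P$ is the orthogonal projection onto $Q$ (if $k=0$, by the usual convention, the least weight of a nonscalar $T\in G_n$ with $PTP\ne0$); $[[n,k,\ge d]]_q$ means parameters $[[n,k,D]]_q$ for some $D\ge d$. -/

import Mathlib

noncomputable section

namespace GMCC

/-! ### Classical codes -/

/-- Hermitian product `∑ i, a i * (b i)^q` on `K ^ ι`, where `K` is the field with `q ^ 2` elements. -/
def hermProd {K ι : Type*} [Field K] [Fintype ι] (q : ℕ) (a b : ι → K) : K :=
  ∑ i, a i * b i ^ q

/-- The dual of `C` for the Hermitian product. -/
def hermDual {K ι : Type*} [Field K] [Fintype ι] (q : ℕ) (C : Submodule K (ι → K)) :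
    Set (ι → K) :=
  {b | ∀ a ∈ C, hermProd q a b = 0}

/-- The dual of `C` for the Euclidean product. -/
def euclDual {K ι : Type*} [Field K] [Fintype ι] (C : Submodule K (ι → K)) :
    Submodule K (ι → K) where
  carrier := {b | ∀ a ∈ C, a ⬝ᵥ b = 0}
  add_mem' := by
    intro x y hx hy a ha
    rw [dotProduct_add, hx a ha, hy a ha, add_zero]
  zero_mem' := by
    intro a _
    exact dotProduct_zero a
  smul_mem' := by
    intro c x hx a ha
    rw [dotProduct_smul, hx a ha, smul_zero]

/-- Minimum distance of a code: the least Hamming distance of two different codewords. -/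
def minDist {K ι : Type*} [DecidableEq K] [Fintype ι] (C : Set (ι → K)) : ℕ :=
  sInf {d | ∃ x ∈ C, ∃ y ∈ C, x ≠ y ∧ hammingDist x y = d}

/-! ### Generalized monomial-Cartesian codes

The index `0 : Fin m` plays the role of the first variable. The set
`E = {0, …, a 0 - 1} × ⋯ × {0, …, a (m-1) - 1}` labels both the exponents of the reduced monomials
and the points of the grid (hence the coordinates of the codewords). -/

/-- The box `E`. -/
abbrev Box {m : ℕ} (a : Fin m → ℕ) : Type := ∀ j : Fin m, Fin (a j)

/-- The point `P_α` of the grid `A 0 × ⋯ × A (m-1)`, where `ξ j` is the chosen ordering of `A j`. -/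
def point {K : Type*} {m : ℕ} {a : Fin m → ℕ} {A : Fin m → Finset K}
    (ξ : ∀ j, Fin (a j) ≃ A j) (α : Box a) : Fin m → K :=
  fun j => (ξ j (α j) : K)

/-- The monomial `X ^ e`. -/
def mono (K : Type*) [Field K] {m : ℕ} {a : Fin m → ℕ} (e : Box a) : MvPolynomial (Fin m) K :=
  ∏ j, MvPolynomial.X j ^ (e j : ℕ)

/-- The space `V_Δ` of the polynomials supported on `Δ`. As `Δ ⊆ E`, they are the reduced
representatives of their classes modulo the vanishing ideal of the grid. -/
def monoSpace (K : Type*) [Field K] {m : ℕ} {a : Fin m → ℕ} (Δ : Finset (Box a)) :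
    Submodule K (MvPolynomial (Fin m) K) :=
  Submodule.span K (mono K '' (Δ : Set (Box a)))

/-- The twisted evaluation map `f ↦ (v_α f(P_α))_α`. -/
def ev {K : Type*} [Field K] {m : ℕ} {a : Fin m → ℕ} {A : Fin m → Finset K}
    (ξ : ∀ j, Fin (a j) ≃ A j) (v : Box a → K) :
    MvPolynomial (Fin m) K →ₗ[K] (Box a → K) where
  toFun f := fun α => v α * MvPolynomial.eval (point ξ α) f
  map_add' f g := by
    funext α
    simp [mul_add]
  map_smul' c f := by
    funext α
    simp [mul_left_comm]

/-- The code `C_{v,Δ} = ev_v (V_Δ)`. -/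
def code {K : Type*} [Field K] {m : ℕ} {a : Fin m → ℕ} {A : Fin m → Finset K}
    (ξ : ∀ j, Fin (a j) ≃ A j) (v : Box a → K) (Δ : Finset (Box a)) :
    Submodule K (Box a → K) :=
  (monoSpace K Δ).map (ev ξ v)

/-- The twist vector. In the lexicographic order of `E` it consists of `q + 1` consecutive blocks
of length `n / (q + 1) = lam * a 1 * ⋯ * a (m-1)`, filled alternately with `η ^ ((q - 1) / 2)` and
with `1`; the block (counted from zero) that contains `α` is number `α 0 / lam`. -/
def twist {K : Type*} [Field K] {m : ℕ} [NeZero m] {a : Fin m → ℕ} (q lam : ℕ) (η : K) :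
    Box a → K :=
  fun α => if Even ((α 0 : ℕ) / lam) then η ^ ((q - 1) / 2) else 1

/-! ### Stabilizer quantum codes

`F` is the field with `q` elements and `p` is its characteristic. -/

/-- The state space of `n` systems with `q` levels: functions on `F ^ n`, that is `ℂ ^ (q ^ n)`
with coordinates labelled by `F ^ n`. -/
abbrev State (F : Type*) (n : ℕ) : Type _ := (Fin n → F) → ℂ

instance (F : Type*) [Field F] [Finite F] : NeZero (ringChar F) :=
  ⟨CharP.ringChar_ne_zero_of_finite F⟩

/-- The absolute trace of `F`, with values in the prime field. -/
def absTrace (F : Type*) [Field F] : F →+ ZMod (ringChar F) :=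
  letI := ZMod.algebra F (ringChar F)
  (Algebra.trace (ZMod (ringChar F)) F).toAddMonoidHom

/-- `ω ^ c` with `ω = exp (2πi / p)`. -/
def omegaPow (F : Type*) [Field F] [Finite F] (c : ZMod (ringChar F)) : ℂ :=
  ZMod.stdAddChar c

/-- The shift operator `X(a)`, which sends `|y⟩` to `|y + a⟩`. -/
def shiftOp {F : Type*} [Field F] {n : ℕ} (a : Fin n → F) : Module.End ℂ (State F n) where
  toFun φ := fun x => φ (x - a)
  map_add' _ _ := rfl
  map_smul' _ _ := rfl

/-- The phase operator `Z(b)`, which sends `|y⟩` to `ω ^ (tr (b · y)) |y⟩`. -/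
def phaseOp {F : Type*} [Field F] [Finite F] {n : ℕ} (b : Fin n → F) :
    Module.End ℂ (State F n) where
  toFun φ := fun x => omegaPow F (absTrace F (b ⬝ᵥ x)) * φ x
  map_add' φ ψ := by
    funext x
    simp [mul_add]
  map_smul' c φ := by
    funext x
    simp [mul_left_comm]

/-- The nice error basis `X(a) Z(b)`. -/
def errorOp {F : Type*} [Field F] [Finite F] {n : ℕ} (a b : Fin n → F) :
    Module.End ℂ (State F n) :=
  shiftOp a * phaseOp b

/-- The weight of the error `X(a) Z(b)`: the number of systems on which it acts nontrivially. -/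
def errorWeight {F : Type*} [Field F] [DecidableEq F] {n : ℕ} (a b : Fin n → F) : ℕ :=
  (Finset.univ.filter fun i => a i ≠ 0 ∨ b i ≠ 0).card

theorem omegaPow_zero (F : Type*) [Field F] [Finite F] : omegaPow F 0 = 1 :=
  AddChar.map_zero_eq_one _

theorem omegaPow_add (F : Type*) [Field F] [Finite F] (c d : ZMod (ringChar F)) :
    omegaPow F (c + d) = omegaPow F c * omegaPow F d :=
  AddChar.map_add_eq_mul _ c d

theorem errorOp_apply {F : Type*} [Field F] [Finite F] {n : ℕ} (a b : Fin n → F) (φ : State F n)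
    (x : Fin n → F) :
    errorOp a b φ x = omegaPow F (absTrace F (b ⬝ᵥ (x - a))) * φ (x - a) := rfl

theorem errorOp_zero {F : Type*} [Field F] [Finite F] {n : ℕ} :
    errorOp (0 : Fin n → F) 0 = 1 := by
  refine LinearMap.ext fun φ => funext fun x => ?_
  rw [errorOp_apply]
  simp [omegaPow_zero]

theorem smul_errorOp_mul {F : Type*} [Field F] [Finite F] {n : ℕ} (c c' : ZMod (ringChar F))
    (a b a' b' : Fin n → F) :
    (omegaPow F c • errorOp a b) * (omegaPow F c' • errorOp a' b') =
      omegaPow F (c + c' + absTrace F (b ⬝ᵥ a')) • errorOp (a + a') (b + b') := by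
  refine LinearMap.ext fun φ => funext fun x => ?_
  have h1 : x - (a + a') = x - a - a' := by abel
  have h2 : b ⬝ᵥ (x - a) = b ⬝ᵥ a' + b ⬝ᵥ (x - a - a') := by
    rw [← dotProduct_add]
    congr 1
    abel
  simp only [Module.End.mul_apply, LinearMap.smul_apply, Pi.smul_apply, errorOp_apply, smul_eq_mul,
    h1, h2, add_dotProduct, map_add, omegaPow_add, map_smul]
  ring

/-- The error group `G_n = {ω ^ c X(a) Z(b)}`, as a group of invertible operators
(this is the standard error group for odd `p`, the only case that is used). -/
def errorGroup (F : Type*) [Field F] [Finite F] (n : ℕ) :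
    Subgroup (Module.End ℂ (State F n))ˣ where
  carrier := {g | ∃ (c : ZMod (ringChar F)) (a b : Fin n → F),
    (g : Module.End ℂ (State F n)) = omegaPow F c • errorOp a b}
  mul_mem' := by
    rintro g h ⟨c, a, b, hg⟩ ⟨c', a', b', hh⟩
    exact ⟨_, _, _, by rw [Units.val_mul, hg, hh, smul_errorOp_mul]⟩
  one_mem' := ⟨0, 0, 0, by rw [errorOp_zero, omegaPow_zero, one_smul, Units.val_one]⟩
  inv_mem' := by
    rintro g ⟨c, a, b, hg⟩
    refine ⟨-c + absTrace F (b ⬝ᵥ a), -a, -b, ?_⟩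
    rw [Units.inv_eq_of_mul_eq_one_right]
    rw [hg, smul_errorOp_mul, add_neg_cancel, add_neg_cancel, errorOp_zero, dotProduct_neg, map_neg]
    have h : c + (-c + absTrace F (b ⬝ᵥ a)) + -absTrace F (b ⬝ᵥ a) = 0 := by abel
    rw [h, omegaPow_zero, one_smul]

/-- A stabilizer code: a nonzero subspace of `ℂ ^ (q ^ n)` that consists of all the vectors fixed
by some abelian subgroup of the error group. -/
def IsStabilizerCode {F : Type*} [Field F] [Finite F] {n : ℕ}
    (Q : Submodule ℂ (State F n)) : Prop :=
  Q ≠ ⊥ ∧ ∃ S : Subgroup (Module.End ℂ (State F n))ˣ,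
    S ≤ errorGroup F n ∧ (∀ g ∈ S, ∀ h ∈ S, g * h = h * g) ∧
      ∀ φ : State F n, φ ∈ Q ↔ ∀ g ∈ S, (g : Module.End ℂ (State F n)) φ = φ

/-- With `P` the orthogonal projection onto `Q`: the operator `T` satisfies `P T P = c P`. -/
def ActsOnCodeAs {F : Type*} [Fintype F] {n : ℕ} (Q : Submodule ℂ (State F n))
    (T : Module.End ℂ (State F n)) (c : ℂ) : Prop :=
  ∀ φ ∈ Q, ∀ ψ ∈ Q, star φ ⬝ᵥ T ψ = c * (star φ ⬝ᵥ ψ)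

/-- The errors `X(a) Z(b)` that count for the minimum distance of `Q`. If `dim Q ≠ 1`, these are
the undetectable ones, i.e. those with `P E P ∉ ℂ P`. A one-dimensional code detects everything
in this sense, and by the usual convention one then counts the errors that differ from
the identity and have `P E P ≠ 0`. -/
def IsUndetectable {F : Type*} [Field F] [Fintype F] {n : ℕ} (Q : Submodule ℂ (State F n))
    (a b : Fin n → F) : Prop :=
  (Module.finrank ℂ Q ≠ 1 ∧ ¬ ∃ c : ℂ, ActsOnCodeAs Q (errorOp a b) c) ∨
  (Module.finrank ℂ Q = 1 ∧ (a ≠ 0 ∨ b ≠ 0) ∧ ¬ ActsOnCodeAs Q (errorOp a b) 0)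

/-- `Q` is an `[[n, k, D]]_q` stabilizer code, `q` being the number of elements of `F`. -/
def IsStabilizerCodeWithParams {F : Type*} [Field F] [Fintype F] [DecidableEq F] {n : ℕ}
    (Q : Submodule ℂ (State F n)) (k D : ℕ) : Prop :=
  IsStabilizerCode Q ∧ Module.finrank ℂ Q = Fintype.card F ^ k ∧
    IsLeast {w | ∃ a b : Fin n → F, IsUndetectable Q a b ∧ errorWeight a b = w} D

end GMCC

end

/-! Self-orthogonality is checked on pairs of monomials. Their Hermitian product factors over the
variables (`hermProd_ev_mono`), and the factor of the first variable is a sum of ±z^i over 0 ≤ i <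
λ(q+1), with z = ζ^(e+qe'). The signs, norms of the twist, change after every λ terms. Shifting i by
λ therefore multiplies the sum by -z^λ, while periodicity leaves it unchanged; so it vanishes unless
z^λ = -1. Now ζ^λ has order q+1, hence z^λ = (ζ^λ)^(e-e'), and |e-e'| < (q+1)/2 excludes -1.

The quantum code comes from writing K = F ⊕ γF with γ^q = -γ. Then h - h^q, for a Hermitian product
h, is 2γ times the symplectic form (`hermProd_pairMap_sub_pow`), so the code becomes an isotropic
subgroup L of F^n × F^n. In odd characteristic the errors of L can be given phases that make them a
group. Averaging this group gives the projection onto its fixed space, and the trace shows that the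
dimension is q^n / |L|. As |L| = q^(2#Δ), this also forces 2#Δ ≤ n.

An undetectable error is nonzero and trace-symplectically orthogonal to L. Since the code is
K-linear, the error then lies in the Hermitian dual, and `minDist_euclDual_le_hammingNorm` carries
it to the Euclidean dual of the untwisted code. -/

namespace GMCC

/-! ### The additive character `ω ^ tr` -/

section Character

variable {F : Type*} [Field F] [Finite F]

theorem exists_absTrace_mul_ne_zero {a : F} (ha : a ≠ 0) : ∃ x, absTrace F (a * x) ≠ 0 := by
  let := ZMod.algebra F (ringChar F)
  exact FiniteField.trace_to_zmod_nondegenerate F ha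

theorem omegaPow_eq_one_iff (c : ZMod (ringChar F)) : omegaPow F c = 1 ↔ c = 0 := by
  rw [← omegaPow_zero F]
  exact ZMod.injective_stdAddChar.eq_iff

theorem star_omegaPow (c : ZMod (ringChar F)) : star (omegaPow F c) = omegaPow F (-c) :=
  (AddChar.map_neg_eq_conj ZMod.stdAddChar c).symm

theorem omegaPow_neg_mul_self (c : ZMod (ringChar F)) : omegaPow F (-c) * omegaPow F c = 1 := by
  rw [← omegaPow_add, neg_add_cancel, omegaPow_zero]

theorem omegaPow_ne_zero (c : ZMod (ringChar F)) : omegaPow F c ≠ 0 :=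
  right_ne_zero_of_mul_eq_one (omegaPow_neg_mul_self c)

/-- The character `x ↦ ω ^ tr (b · x)` of `F ^ n`. -/
noncomputable def dotChar {n : ℕ} (b : Fin n → F) : AddChar (Fin n → F) ℂ where
  toFun x := omegaPow F (absTrace F (b ⬝ᵥ x))
  map_zero_eq_one' := by simp [omegaPow_zero]
  map_add_eq_mul' x y := by rw [dotProduct_add, map_add, omegaPow_add]

theorem dotChar_apply {n : ℕ} (b x : Fin n → F) :
    dotChar b x = omegaPow F (absTrace F (b ⬝ᵥ x)) := rfl

theorem dotChar_comm {n : ℕ} (b x : Fin n → F) : dotChar b x = dotChar x b := by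
  rw [dotChar_apply, dotChar_apply, dotProduct_comm]

theorem dotChar_ne_one {n : ℕ} {b : Fin n → F} (hb : b ≠ 0) : dotChar b ≠ 1 := by
  obtain ⟨i, hi⟩ := Function.ne_iff.mp hb
  obtain ⟨x, hx⟩ := exists_absTrace_mul_ne_zero hi
  intro h
  have h1 := DFunLike.congr_fun h (Pi.single i x)
  rw [dotChar_apply, dotProduct_single, AddChar.one_apply, omegaPow_eq_one_iff] at h1
  exact hx h1

end Character

theorem sum_dotChar {F : Type*} [Field F] [Fintype F] [DecidableEq F] {n : ℕ} (b : Fin n → F) :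
    ∑ x, dotChar b x = if b = 0 then (Fintype.card F : ℂ) ^ n else 0 := by
  split_ifs with hb
  · subst hb
    simp [dotChar_apply, omegaPow_zero]
  · exact AddChar.sum_eq_zero_of_ne_one (dotChar_ne_one hb)

/-! ### Traces and matrix coefficients of the error operators -/

section ErrorOp

variable {F : Type*} [Field F] [Fintype F] {n : ℕ}

/-- A nonzero shift moves every basis vector, so the diagonal is zero. Without a shift the diagonal
carries a character, whose sum vanishes unless the character is trivial. -/
theorem trace_errorOp [DecidableEq F] (a b : Fin n → F) :
    LinearMap.trace ℂ (State F n) (errorOp a b) =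
      if a = 0 ∧ b = 0 then (Fintype.card F : ℂ) ^ n else 0 := by
  rw [LinearMap.trace_eq_matrix_trace ℂ (Pi.basisFun ℂ (Fin n → F)), Matrix.trace]
  have hdiag : ∀ x, Matrix.diag (LinearMap.toMatrix (Pi.basisFun ℂ (Fin n → F))
      (Pi.basisFun ℂ (Fin n → F)) (errorOp a b)) x = if a = 0 then dotChar b x else 0 := by
    intro x
    rw [Matrix.diag_apply, LinearMap.toMatrix_apply, Pi.basisFun_apply, Pi.basisFun_repr,
      errorOp_apply]
    split_ifs with ha
    · simp [ha, dotChar_apply]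
    · rw [Pi.single_eq_of_ne (by simpa using ha), mul_zero]
  simp_rw [hdiag]
  by_cases ha : a = 0
  · simp [ha, sum_dotChar]
  · simp [ha]

theorem star_errorOp_dotProduct_errorOp (a b : Fin n → F) (φ ψ : State F n) :
    star (errorOp a b φ) ⬝ᵥ errorOp a b ψ = star φ ⬝ᵥ ψ := by
  simp only [dotProduct, Pi.star_apply, errorOp_apply, star_mul', star_omegaPow]
  rw [← Equiv.sum_comp (Equiv.subRight a) fun x => star (φ x) * ψ x]
  refine Finset.sum_congr rfl fun x _ => ?_
  rw [Equiv.subRight_apply, mul_mul_mul_comm, omegaPow_neg_mul_self, one_mul]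

/-- Up to the factor `q ^ n`, the rank one operator `|x⟩⟨y|` is a combination of error operators. -/
theorem sum_dotChar_smul_errorOp [DecidableEq F] (x y : Fin n → F) (φ ψ : State F n) :
    ∑ b, dotChar (-y) b * (star φ ⬝ᵥ errorOp (x - y) b ψ) =
      (Fintype.card F : ℂ) ^ n * (star (φ x) * ψ y) := by
  -- The two characters merge into one with argument z - x, so summing over b leaves only the term z
  -- = x.
  have h : ∀ z b, dotChar (-y) b * (star (φ z) * (dotChar b (z - (x - y)) * ψ (z - (x - y)))) =
      dotChar (z - x) b * (star (φ z) * ψ (z - (x - y))) := by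
    intro z b
    have : z - x = -y + (z - (x - y)) := by abel
    rw [this, dotChar_comm (-y + _), AddChar.map_add_eq_mul, dotChar_comm b (-y)]
    ring
  have hd : ∀ b, star φ ⬝ᵥ errorOp (x - y) b ψ =
      ∑ z, star (φ z) * (dotChar b (z - (x - y)) * ψ (z - (x - y))) := fun _ => rfl
  simp only [hd, Finset.mul_sum, h]
  rw [Finset.sum_comm]
  simp only [← Finset.sum_mul, sum_dotChar, sub_eq_zero]
  rw [Finset.sum_eq_single x (fun z _ hz => by simp [hz]) (by simp)]
  simp

end ErrorOp

/-! ### Weyl operators -/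

section Weyl

variable {F : Type*} [Field F] {n : ℕ}

/-- The symplectic form on `F ^ n × F ^ n`. -/
def symp (u v : (Fin n → F) × (Fin n → F)) : F := u.2 ⬝ᵥ v.1 - u.1 ⬝ᵥ v.2

theorem symp_swap (u v : (Fin n → F) × (Fin n → F)) : symp v u = -symp u v := by
  rw [symp, symp, dotProduct_comm v.2, dotProduct_comm v.1, neg_sub]

variable [Finite F]

/-- The error `X(a) Z(b)`, with the phase that turns multiplication into addition on isotropic
subgroups. -/
noncomputable def weyl (u : (Fin n → F) × (Fin n → F)) : Module.End ℂ (State F n) :=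
  omegaPow F (absTrace F (2⁻¹ * (u.1 ⬝ᵥ u.2))) • errorOp u.1 u.2

theorem weyl_zero : weyl (0 : (Fin n → F) × (Fin n → F)) = 1 := by
  simp [weyl, errorOp_zero, omegaPow_zero]

/-- Multiplying the errors produces the phase b · a'. The halves built into `weyl` subtract (a · b'
+ b · a') / 2 from it, which leaves half the symplectic form. -/
theorem weyl_mul (h2 : (2 : F) ≠ 0) (u v : (Fin n → F) × (Fin n → F)) :
    weyl u * weyl v = omegaPow F (absTrace F (2⁻¹ * symp u v)) • weyl (u + v) := by
  rw [weyl, weyl, weyl, smul_errorOp_mul, smul_smul, ← omegaPow_add, ← map_add, ← map_add,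
    ← map_add, Prod.fst_add, Prod.snd_add, symp]
  congr 3
  simp only [add_dotProduct, dotProduct_add, dotProduct_comm v.1 u.2]
  field_simp
  ring

theorem weyl_mul_comm (h2 : (2 : F) ≠ 0) (u v : (Fin n → F) × (Fin n → F)) :
    weyl u * weyl v = omegaPow F (absTrace F (symp u v)) • (weyl v * weyl u) := by
  rw [weyl_mul h2, weyl_mul h2, smul_smul, ← omegaPow_add, ← map_add, symp_swap u v, add_comm v u]
  congr 3
  field_simp
  ring

theorem errorOp_eq_smul_weyl (u : (Fin n → F) × (Fin n → F)) :
    errorOp u.1 u.2 = omegaPow F (-absTrace F (2⁻¹ * (u.1 ⬝ᵥ u.2))) • weyl u := by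
  rw [weyl, smul_smul, omegaPow_neg_mul_self, one_smul]

theorem weyl_neg_mul_self (h2 : (2 : F) ≠ 0) (u : (Fin n → F) × (Fin n → F)) :
    weyl (-u) * weyl u = 1 := by
  rw [weyl_mul h2, neg_add_cancel, weyl_zero]
  simp [symp, dotProduct_comm, omegaPow_zero]

theorem weyl_mul_neg_self (h2 : (2 : F) ≠ 0) (u : (Fin n → F) × (Fin n → F)) :
    weyl u * weyl (-u) = 1 := by
  simpa using weyl_neg_mul_self h2 (-u)

end Weyl

theorem star_weyl_dotProduct_weyl {F : Type*} [Field F] [Fintype F] {n : ℕ}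
    (u : (Fin n → F) × (Fin n → F)) (φ ψ : State F n) :
    star (weyl u φ) ⬝ᵥ weyl u ψ = star φ ⬝ᵥ ψ := by
  simp only [weyl, LinearMap.smul_apply, star_smul, smul_dotProduct, dotProduct_smul,
    star_errorOp_dotProduct_errorOp, star_omegaPow, smul_smul, mul_comm _ (omegaPow F (-_)),
    omegaPow_neg_mul_self, one_smul]

theorem trace_weyl {F : Type*} [Field F] [Fintype F] [DecidableEq F] {n : ℕ}
    (u : (Fin n → F) × (Fin n → F)) :
    LinearMap.trace ℂ (State F n) (weyl u) = if u = 0 then (Fintype.card F : ℂ) ^ n else 0 := by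
  rw [weyl, map_smul, trace_errorOp]
  by_cases hu : u = 0
  · simp [hu, omegaPow_zero]
  · rw [if_neg hu, if_neg (fun h => hu (Prod.ext h.1 h.2)), smul_zero]

/-! ### The stabilizer code of an isotropic subgroup -/

open scoped ComplexOrder in
theorem star_dotProduct_self_ne_zero {ι : Type*} [Fintype ι] {φ : ι → ℂ} (h : φ ≠ 0) : star φ ⬝ᵥ φ ≠ 0 :=
  fun h0 => h (dotProduct_star_self_eq_zero.mp h0)

section Stabilizer

variable {F : Type*} [Field F] {n : ℕ}

/-- The states fixed by all Weyl operators of `L`. -/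
noncomputable def fixedSpace [Finite F] (L : AddSubgroup ((Fin n → F) × (Fin n → F))) :
    Submodule ℂ (State F n) where
  carrier := {φ | ∀ u ∈ L, weyl u φ = φ}
  add_mem' hφ hψ u hu := by rw [map_add, hφ u hu, hψ u hu]
  zero_mem' _ _ := map_zero _
  smul_mem' c φ hφ u hu := by rw [map_smul, hφ u hu]

/-- The subgroup `L` is totally isotropic for the symplectic form. -/
def IsIsotropic (L : AddSubgroup ((Fin n → F) × (Fin n → F))) : Prop :=
  ∀ u ∈ L, ∀ v ∈ L, symp u v = 0

variable {L : AddSubgroup ((Fin n → F) × (Fin n → F))}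

theorem IsIsotropic.weyl_mul [Finite F] (hL : IsIsotropic L) (h2 : (2 : F) ≠ 0)
    {u v : (Fin n → F) × (Fin n → F)} (hu : u ∈ L) (hv : v ∈ L) :
    weyl u * weyl v = weyl (u + v) := by
  rw [GMCC.weyl_mul h2, hL u hu v hv, mul_zero, map_zero, omegaPow_zero, one_smul]

/-- The Weyl operators of an isotropic subgroup form a stabilizer group. -/
noncomputable def weylSubgroup [Finite F] (hL : IsIsotropic L) (h2 : (2 : F) ≠ 0) :
    Subgroup (Module.End ℂ (State F n))ˣ where
  carrier := {g | ∃ u ∈ L, (g : Module.End ℂ (State F n)) = weyl u}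
  mul_mem' := by
    rintro g h ⟨u, hu, hg⟩ ⟨v, hv, hh⟩
    exact ⟨u + v, L.add_mem hu hv, by rw [Units.val_mul, hg, hh, hL.weyl_mul h2 hu hv]⟩
  one_mem' := ⟨0, L.zero_mem, by rw [weyl_zero, Units.val_one]⟩
  inv_mem' := by
    rintro g ⟨u, hu, hg⟩
    refine ⟨-u, L.neg_mem hu, ?_⟩
    rw [Units.inv_eq_of_mul_eq_one_right]
    rw [hg, weyl_mul_neg_self h2]

theorem isStabilizerCode_fixedSpace [Finite F] (hL : IsIsotropic L) (h2 : (2 : F) ≠ 0)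
    (hne : fixedSpace L ≠ ⊥) : IsStabilizerCode (fixedSpace L) := by
  refine ⟨hne, weylSubgroup hL h2, ?_, ?_, fun φ => ⟨?_, ?_⟩⟩
  · rintro g ⟨u, -, hg⟩
    exact ⟨_, u.1, u.2, hg⟩
  · rintro g ⟨u, hu, hg⟩ h ⟨v, hv, hh⟩
    exact Units.ext (by rw [Units.val_mul, Units.val_mul, hg, hh, hL.weyl_mul h2 hu hv,
      hL.weyl_mul h2 hv hu, add_comm])
  · rintro hφ g ⟨u, hu, hg⟩
    rw [hg]
    exact hφ u hu
  · intro h u hu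
    exact h ⟨weyl u, weyl (-u), weyl_mul_neg_self h2 u, weyl_neg_mul_self h2 u⟩ ⟨u, hu, rfl⟩

variable [Fintype F]

/-- Averaging over a group projects onto its invariants: multiplying by one element only permutes
the summands. -/
theorem isProj_fixedSpace [Fintype L] (hL : IsIsotropic L) (h2 : (2 : F) ≠ 0) :
    LinearMap.IsProj (fixedSpace L)
      ((Fintype.card L : ℂ)⁻¹ • ∑ u : L, weyl (u : (Fin n → F) × (Fin n → F))) where
  map_mem φ u hu := by
    rw [LinearMap.smul_apply, map_smul, LinearMap.sum_apply, map_sum,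
      ← Equiv.sum_comp (Equiv.addLeft (⟨u, hu⟩ : L)) fun v => weyl v φ]
    refine congrArg _ (Finset.sum_congr rfl fun v _ => ?_)
    rw [← Module.End.mul_apply, hL.weyl_mul h2 hu v.2]
    rfl
  map_id φ hφ := by
    rw [LinearMap.smul_apply, LinearMap.sum_apply, Finset.sum_congr rfl fun u _ => hφ _ u.2]
    rw [Finset.sum_const, Finset.card_univ, ← Nat.cast_smul_eq_nsmul ℂ, smul_smul,
      inv_mul_cancel₀ (Nat.cast_ne_zero.mpr Fintype.card_ne_zero), one_smul]

/-- The rank of a projection is its trace, and in the average only the identity has nonzero trace,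
namely q^n. -/
theorem finrank_fixedSpace_mul_card (hL : IsIsotropic L) (h2 : (2 : F) ≠ 0) :
    Module.finrank ℂ (fixedSpace L) * Nat.card L = Fintype.card F ^ n := by
  classical
  have : Fintype L := Fintype.ofFinite L
  have h := (isProj_fixedSpace hL h2).trace
  simp only [map_smul, map_sum, trace_weyl, ZeroMemClass.coe_eq_zero, Finset.sum_ite_eq',
    Finset.mem_univ, if_true, smul_eq_mul] at h
  have hcard : (Fintype.card L : ℂ) ≠ 0 := Nat.cast_ne_zero.mpr Fintype.card_ne_zero
  rw [inv_mul_eq_iff_eq_mul₀ hcard] at h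
  rw [Nat.card_eq_fintype_card, mul_comm]
  exact_mod_cast h.symm

/-- An error that anticommutes, up to a nontrivial phase, with a stabilizer maps the code to
an orthogonal space. -/
theorem actsOnCodeAs_zero_of_symp_ne_zero (h2 : (2 : F) ≠ 0) {u v : (Fin n → F) × (Fin n → F)}
    (hu : u ∈ L) (huv : absTrace F (symp u v) ≠ 0) :
    ActsOnCodeAs (fixedSpace L) (errorOp v.1 v.2) 0 := by
  have key : ∀ φ ∈ fixedSpace L, ∀ ψ ∈ fixedSpace L, star φ ⬝ᵥ weyl v ψ = 0 := by
    intro φ hφ ψ hψ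
    -- Apply the unitary `weyl u` to both arguments. It fixes φ and ψ, and passing it through `weyl
    -- v` costs a phase different from 1.
    have h1 : star φ ⬝ᵥ weyl v ψ =
        omegaPow F (absTrace F (symp u v)) * (star φ ⬝ᵥ weyl v ψ) := by
      conv_lhs => rw [← star_weyl_dotProduct_weyl u, hφ u hu]
      rw [← Module.End.mul_apply, weyl_mul_comm h2, LinearMap.smul_apply, Module.End.mul_apply,
        hψ u hu, dotProduct_smul, smul_eq_mul]
    by_contra h0
    exact huv ((omegaPow_eq_one_iff _).mp (mul_right_cancel₀ h0 (by rw [one_mul, ← h1])))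
  intro φ hφ ψ hψ
  rw [errorOp_eq_smul_weyl, LinearMap.smul_apply, dotProduct_smul, key φ hφ ψ hψ, smul_zero,
    zero_mul]

theorem actsOnCodeAs_of_mem {v : (Fin n → F) × (Fin n → F)} (hv : v ∈ L) :
    ActsOnCodeAs (fixedSpace L) (errorOp v.1 v.2)
      (omegaPow F (-absTrace F (2⁻¹ * (v.1 ⬝ᵥ v.2)))) := by
  intro φ _ ψ hψ
  rw [errorOp_eq_smul_weyl, LinearMap.smul_apply, hψ v hv, dotProduct_smul, smul_eq_mul]

/-- Undetectable errors are nonzero and commute with all stabilizers. -/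
theorem IsUndetectable.ne_zero_and_symp_eq_zero (h2 : (2 : F) ≠ 0) {a b : Fin n → F}
    (h : IsUndetectable (fixedSpace L) a b) :
    (a, b) ≠ 0 ∧ ∀ u ∈ L, absTrace F (symp u (a, b)) = 0 := by
  constructor
  · rintro h0
    rcases h with ⟨-, h⟩ | ⟨-, h, -⟩
    · have h1 := actsOnCodeAs_of_mem (L := L) (v := (a, b)) (h0 ▸ L.zero_mem)
      exact h ⟨_, h1⟩
    · simp only [Prod.mk_eq_zero] at h0
      exact h.elim (fun h => h h0.1) (fun h => h h0.2)
  · intro u hu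
    by_contra huv
    have h0 := actsOnCodeAs_zero_of_symp_ne_zero h2 hu huv
    rcases h with ⟨-, h⟩ | ⟨-, -, h⟩
    · exact h ⟨0, h0⟩
    · exact h h0

/-- Since the errors span all operators, they cannot all act as scalars on a code of dimension
at least two. -/
theorem exists_not_actsOnCodeAs {Q : Submodule ℂ (State F n)} (hQ : 1 < Module.finrank ℂ Q) :
    ∃ a b : Fin n → F, ¬ ∃ c : ℂ, ActsOnCodeAs Q (errorOp a b) c := by
  classical
  by_contra! hall
  choose c hc using hall
  obtain ⟨φ, hφ, hφ0⟩ : ∃ φ ∈ Q, φ ≠ 0 :=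
    Q.ne_bot_iff.mp fun h => by rw [h, finrank_bot] at hQ; lia
  obtain ⟨y, hy⟩ := Function.ne_iff.mp hφ0
  -- Evaluation at y is one linear condition, so it has a nonzero kernel on a space of dimension at
  -- least two.
  obtain ⟨ψ, hψ, hψ0⟩ : ∃ ψ : Q, (ψ : State F n) y = 0 ∧ ψ ≠ 0 := by
    have hker : 0 < Module.finrank ℂ
        (LinearMap.ker (((LinearMap.proj y : State F n →ₗ[ℂ] ℂ)).comp Q.subtype)) := by
      have h1 := LinearMap.finrank_range_add_finrank_ker
        (((LinearMap.proj y : State F n →ₗ[ℂ] ℂ)).comp Q.subtype)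
      have h2 := Submodule.finrank_le
        (LinearMap.range (((LinearMap.proj y : State F n →ₗ[ℂ] ℂ)).comp Q.subtype))
      rw [Module.finrank_self] at h2
      lia
    obtain ⟨ψ, hψ, hψ0⟩ := Submodule.exists_mem_ne_zero_of_ne_bot
      (Submodule.one_le_finrank_iff.mp hker)
    exact ⟨ψ, hψ, hψ0⟩
  -- The operator |y⟩⟨y| would act on Q as a scalar. Testing on ψ makes this scalar zero, testing on
  -- φ makes it nonzero.
  have key : ∀ φ ∈ Q, ∀ ψ ∈ Q, (Fintype.card F : ℂ) ^ n * (star (φ y) * ψ y) =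
      (∑ b, dotChar (-y) b * c (y - y) b) * (star φ ⬝ᵥ ψ) := by
    intro φ hφ ψ hψ
    rw [← sum_dotChar_smul_errorOp, Finset.sum_mul]
    exact Finset.sum_congr rfl fun b _ => by rw [hc _ _ φ hφ ψ hψ, mul_assoc]
  have hcard : (Fintype.card F : ℂ) ^ n ≠ 0 :=
    pow_ne_zero _ (Nat.cast_ne_zero.mpr Fintype.card_ne_zero)
  have h1 := key ψ ψ.2 ψ ψ.2
  rw [hψ, mul_zero, mul_zero, eq_comm, mul_eq_zero, or_iff_left
    (star_dotProduct_self_ne_zero fun h => hψ0 (Subtype.ext h))] at h1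
  have h2 := key φ hφ φ hφ
  rw [h1, zero_mul] at h2
  exact mul_ne_zero hcard (mul_ne_zero (star_ne_zero.mpr hy) hy) h2

/-- Needed for the minimum distance to be attained. In dimension one |L| = q^n > 1, and any nonzero
element of L serves: it acts on the code as a nonzero phase. -/
theorem exists_isUndetectable_fixedSpace (hL : IsIsotropic L) (h2 : (2 : F) ≠ 0) (hn : n ≠ 0)
    (hne : fixedSpace L ≠ ⊥) : ∃ a b, IsUndetectable (fixedSpace L) a b := by
  by_cases h1 : Module.finrank ℂ (fixedSpace L) = 1
  · have hcard := finrank_fixedSpace_mul_card hL h2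
    rw [h1, one_mul] at hcard
    have hL0 : L ≠ ⊥ := by
      rintro rfl
      rw [AddSubgroup.card_bot, eq_comm] at hcard
      exact (Nat.one_lt_pow hn Fintype.one_lt_card).ne' hcard
    obtain ⟨v, hv, hv0⟩ := L.bot_or_exists_ne_zero.resolve_left hL0
    refine ⟨v.1, v.2, Or.inr ⟨h1, ?_, fun h0 => ?_⟩⟩
    · by_contra! h
      exact hv0 (Prod.ext h.1 h.2)
    · obtain ⟨φ, hφ, hφ0⟩ := (fixedSpace L).ne_bot_iff.mp hne
      have h3 := h0 φ hφ φ hφ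
      rw [actsOnCodeAs_of_mem hv φ hφ φ hφ, zero_mul] at h3
      exact mul_ne_zero (omegaPow_ne_zero _) (star_dotProduct_self_ne_zero hφ0) h3
  · have h3 := Submodule.one_le_finrank_iff.mpr hne
    obtain ⟨a, b, hab⟩ := exists_not_actsOnCodeAs (Q := fixedSpace L) (by lia)
    exact ⟨a, b, Or.inl ⟨h1, hab⟩⟩

/-- The stabilizer construction: an isotropic subgroup with `q ^ (n - k)` elements gives
an `[[n, k, D]]_q` code, where `D` is at least the weight of every nonzero element of its
trace-symplectic dual. -/
theorem IsIsotropic.exists_isStabilizerCodeWithParams [DecidableEq F] (hL : IsIsotropic L)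
    (h2 : (2 : F) ≠ 0) (hn : n ≠ 0) {r : ℕ} (hcard : Nat.card L = Fintype.card F ^ r) {d : ℕ}
    (hd : ∀ v : (Fin n → F) × (Fin n → F), v ≠ 0 →
      (∀ u ∈ L, absTrace F (symp u v) = 0) → d ≤ errorWeight v.1 v.2) :
    ∃ k, k + r = n ∧ ∃ D, d ≤ D ∧
      ∃ Q : Submodule ℂ (State F n), IsStabilizerCodeWithParams Q k D := by
  have hdim := finrank_fixedSpace_mul_card hL h2
  rw [hcard] at hdim
  have hq : 1 < Fintype.card F := Fintype.one_lt_card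
  have hrn : r ≤ n := (Nat.pow_dvd_pow_iff_le_right hq).mp ⟨_, by rw [mul_comm, hdim]⟩
  obtain ⟨k, rfl⟩ := Nat.exists_eq_add_of_le' hrn
  have hk : Module.finrank ℂ (fixedSpace L) = Fintype.card F ^ k := by
    rw [pow_add] at hdim
    exact Nat.eq_of_mul_eq_mul_right (by positivity) hdim
  have hne : fixedSpace L ≠ ⊥ := by
    intro h
    rw [h, finrank_bot] at hk
    exact (pow_pos (by lia) k).ne hk
  let W := {w | ∃ a b : Fin (k + r) → F, IsUndetectable (fixedSpace L) a b ∧ errorWeight a b = w}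
  have hW : W.Nonempty := by
    obtain ⟨a, b, h⟩ := exists_isUndetectable_fixedSpace hL h2 hn hne
    exact ⟨_, a, b, h, rfl⟩
  refine ⟨k, rfl, sInf W, ?_, fixedSpace L, isStabilizerCode_fixedSpace hL h2 hne, hk,
    Nat.sInf_mem hW, fun w hw => Nat.sInf_le hw⟩
  obtain ⟨a, b, h, hw⟩ := Nat.sInf_mem hW
  rw [← hw]
  obtain ⟨h0, hab⟩ := h.ne_zero_and_symp_eq_zero h2
  exact hd (a, b) h0 hab

end Stabilizer

/-! ### Finite fields with `q` and `q ^ 2` elements -/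

theorem exists_ringHom_eq_pow {K : Type*} [Field K] [Fintype K] {q : ℕ}
    (hK : Fintype.card K = q ^ 2) : ∃ φ : K →+* K, ∀ x, φ x = x ^ q := by
  obtain ⟨p, _, t, hp, ht⟩ := FiniteField.card' K
  have : Fact p.Prime := ⟨hp⟩
  obtain ⟨s, -, rfl⟩ := (Nat.dvd_prime_pow hp).mp
    (show q ∣ p ^ (t : ℕ) from ht ▸ hK ▸ dvd_pow_self q two_ne_zero)
  exact ⟨iterateFrobenius K p s, fun x => iterateFrobenius_def p s x⟩

/-- The characteristics agree, and the degree of K over the prime field is twice that of F, hence a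
multiple of it. -/
theorem nonempty_ringHom_of_card {F K : Type*} [Field F] [Fintype F] [Field K] [Fintype K]
    (h : Fintype.card K = Fintype.card F ^ 2) : Nonempty (F →+* K) := by
  have hp := CharP.char_is_prime F (ringChar F)
  have : Fact (ringChar F).Prime := ⟨hp⟩
  have : CharP K (ringChar F) := by
    refine (CharP.charP_iff_prime_eq_zero hp).mpr ?_
    have h0 : ((Fintype.card K : ℕ) : K) = 0 := Nat.cast_card_eq_zero K
    obtain ⟨s, -, hs⟩ := FiniteField.card F (ringChar F)
    rw [h, hs, ← pow_mul, Nat.cast_pow] at h0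
    exact eq_zero_of_pow_eq_zero h0
  let := ZMod.algebra F (ringChar F)
  let := ZMod.algebra K (ringChar F)
  have hF := FiniteField.pow_finrank_eq_card (ringChar F) F
  have hK := FiniteField.pow_finrank_eq_card (ringChar F) K
  rw [h, ← hF, ← pow_mul] at hK
  have hdvd := Nat.pow_right_injective hp.two_le hK
  obtain ⟨f⟩ := FiniteField.nonempty_algHom_of_finrank_dvd (F := ZMod (ringChar F)) (K := F)
    (L := K) ⟨2, hdvd⟩
  exact ⟨f.toRingHom⟩

theorem two_ne_zero_of_odd_card {F : Type*} [Field F] [Fintype F] (h : Odd (Fintype.card F)) :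
    (2 : F) ≠ 0 :=
  fun h2 => by
    obtain ⟨s, hs⟩ := h
    have h0 := Nat.cast_card_eq_zero F
    rw [hs, Nat.cast_add, Nat.cast_mul, Nat.cast_two, h2, zero_mul, zero_add, Nat.cast_one] at h0
    exact one_ne_zero h0

/-! ### Hermitian self-orthogonal codes and isotropic subgroups -/

section Hermitian

variable {F K ι : Type*} [Field F] [Field K] {n : ℕ}

/-- The map `(a, b) ↦ a + γ b`, which identifies `F ^ n × F ^ n` with `K ^ n` when `1, γ` is
a basis of `K` over `F`. -/
def pairMap (σ : F →+* K) (γ : K) (e : ι ≃ Fin n) : (Fin n → F) × (Fin n → F) →+ (ι → K) where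
  toFun u i := σ (u.1 (e i)) + γ * σ (u.2 (e i))
  map_zero' := by
    funext i
    simp
  map_add' u v := by
    funext i
    simp only [Prod.fst_add, Prod.snd_add, Pi.add_apply, map_add]
    ring

variable {σ : F →+* K} {γ : K} {e : ι ≃ Fin n} {q : ℕ}

theorem pairMap_apply (u : (Fin n → F) × (Fin n → F)) (i : ι) :
    pairMap σ γ e u i = σ (u.1 (e i)) + γ * σ (u.2 (e i)) := rfl

/-- The q-th power map plays the role of complex conjugation, with γ as the imaginary unit. -/
theorem add_mul_pow_eq {φ : K →+* K} (hφ : ∀ x, φ x = x ^ q) (hσ : ∀ x, σ x ^ q = σ x)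
    (hγ : γ ^ q = -γ) (a b : F) : (σ a + γ * σ b) ^ q = σ a - γ * σ b := by
  rw [← hφ, map_add, map_mul, hφ, hφ, hφ, hσ, hσ, hγ, neg_mul, sub_eq_add_neg]

theorem add_mul_eq_zero_iff {φ : K →+* K} (hφ : ∀ x, φ x = x ^ q) (hq : q ≠ 0)
    (hσ : ∀ x, σ x ^ q = σ x) (hγ : γ ^ q = -γ) (hγ0 : γ ≠ 0) (h2 : (2 : F) ≠ 0) {a b : F} :
    σ a + γ * σ b = 0 ↔ a = 0 ∧ b = 0 := by
  refine ⟨fun h => ?_, fun ⟨ha, hb⟩ => by simp [ha, hb]⟩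
  have h' := add_mul_pow_eq hφ hσ hγ a b
  rw [h, zero_pow hq] at h'
  have ha : σ (2 * a) = 0 := by
    rw [map_mul, map_ofNat]
    linear_combination h - h'
  rw [map_eq_zero, mul_eq_zero, or_iff_right h2] at ha
  rw [ha, map_zero, zero_add, mul_eq_zero, or_iff_right hγ0, map_eq_zero] at h
  exact ⟨ha, h⟩

theorem hermProd_pairMap_sub_pow [Fintype ι] {φ : K →+* K} (hφ : ∀ x, φ x = x ^ q)
    (hσ : ∀ x, σ x ^ q = σ x) (hγ : γ ^ q = -γ) (u v : (Fin n → F) × (Fin n → F)) :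
    hermProd q (pairMap σ γ e u) (pairMap σ γ e v) -
      hermProd q (pairMap σ γ e u) (pairMap σ γ e v) ^ q = 2 * γ * σ (symp u v) := by
  have hsum : ∀ f : Fin n → F, σ (∑ i, f i) = ∑ i, σ (f (e i)) := fun f => by
    rw [map_sum, ← Equiv.sum_comp e]
  rw [hermProd, ← hφ, map_sum, ← Finset.sum_sub_distrib, symp, map_sub, dotProduct, dotProduct,
    hsum, hsum, ← Finset.sum_sub_distrib, Finset.mul_sum]
  refine Finset.sum_congr rfl fun i _ => ?_
  rw [map_mul, map_pow, hφ, hφ, pairMap_apply, pairMap_apply, add_mul_pow_eq hφ hσ hγ,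
    add_mul_pow_eq hφ hσ hγ, sub_eq_add_neg (σ (v.1 _)), ← mul_neg, ← map_neg,
    add_mul_pow_eq hφ hσ hγ, map_neg, map_mul, map_mul]
  ring

theorem errorWeight_eq_hammingNorm_pairMap [Fintype ι] [DecidableEq F] [DecidableEq K]
    {φ : K →+* K} (hφ : ∀ x, φ x = x ^ q) (hq : q ≠ 0)
    (hσ : ∀ x, σ x ^ q = σ x) (hγ : γ ^ q = -γ) (hγ0 : γ ≠ 0) (h2 : (2 : F) ≠ 0)
    (u : (Fin n → F) × (Fin n → F)) :
    errorWeight u.1 u.2 = hammingNorm (pairMap σ γ e u) := by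
  rw [errorWeight, hammingNorm]
  refine (Finset.card_equiv e fun i => ?_).symm
  simp only [Finset.mem_filter, Finset.mem_univ, true_and, pairMap_apply, ne_eq,
    add_mul_eq_zero_iff hφ hq hσ hγ hγ0 h2]
  tauto

variable [Fintype F] [Fintype K]

theorem bijective_pairMap [Fintype ι] {φ : K →+* K} (hφ : ∀ x, φ x = x ^ q) (hq : q ≠ 0)
    (hσ : ∀ x, σ x ^ q = σ x) (hγ : γ ^ q = -γ) (hγ0 : γ ≠ 0) (h2 : (2 : F) ≠ 0)
    (hK : Fintype.card K = Fintype.card F ^ 2) : Function.Bijective (pairMap σ γ e) := by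
  classical
  refine (Fintype.bijective_iff_injective_and_card _).mpr ⟨?_, ?_⟩
  · refine (injective_iff_map_eq_zero _).mpr fun u hu => ?_
    have h : ∀ i, u.1 i = 0 ∧ u.2 i = 0 := fun i => by
      have hi := congrFun hu (e.symm i)
      rwa [pairMap_apply, e.apply_symm_apply, Pi.zero_apply,
        add_mul_eq_zero_iff hφ hq hσ hγ hγ0 h2] at hi
    exact Prod.ext (funext fun i => (h i).1) (funext fun i => (h i).2)
  · rw [Fintype.card_prod, Fintype.card_fun, Fintype.card_fun, hK, Fintype.card_fin,
      Fintype.card_congr e, Fintype.card_fin]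
    ring

/-- The Hermitian construction of stabilizer codes in odd characteristic. -/
theorem exists_isStabilizerCodeWithParams_of_subset_hermDual [Fintype ι] [Nonempty ι]
    [DecidableEq F] [DecidableEq K] (hF : Fintype.card F = q) (hK : Fintype.card K = q ^ 2)
    (hodd : Odd q) (hγ : γ ^ q = -γ) (hγ0 : γ ≠ 0) (hn : Fintype.card ι = n)
    {C : Submodule K (ι → K)} (hC : (C : Set (ι → K)) ⊆ hermDual q C) {d : ℕ}
    (hd : ∀ y ∈ hermDual q C, y ≠ 0 → d ≤ hammingNorm y) :
    ∃ k, k + 2 * Module.finrank K C = n ∧ ∃ D, d ≤ D ∧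
      ∃ Q : Submodule ℂ (State F n), IsStabilizerCodeWithParams Q k D := by
  obtain ⟨σ⟩ := nonempty_ringHom_of_card (hF ▸ hK)
  obtain ⟨φ, hφ⟩ := exists_ringHom_eq_pow hK
  have h2 : (2 : F) ≠ 0 := two_ne_zero_of_odd_card (hF ▸ hodd)
  have h2K : (2 : K) * γ ≠ 0 := by
    refine mul_ne_zero ?_ hγ0
    rw [← map_ofNat σ 2]
    exact (map_ne_zero σ).mpr h2
  have hσ : ∀ x, σ x ^ q = σ x := fun x => by rw [← map_pow, ← hF, FiniteField.pow_card]
  have hq : q ≠ 0 := hodd.pos.ne'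
  let e : ι ≃ Fin n := Fintype.equivFinOfCardEq hn
  have hbij : Function.Bijective (pairMap σ γ e) :=
    bijective_pairMap hφ hq hσ hγ hγ0 h2 (hF ▸ hK)
  let L := C.toAddSubgroup.comap (pairMap σ γ e)
  have hmem : ∀ u, u ∈ L ↔ pairMap σ γ e u ∈ C := fun u => Iff.rfl
  have hL : IsIsotropic L := fun u hu v hv => by
    have h := hermProd_pairMap_sub_pow (e := e) hφ hσ hγ u v
    rw [hC hv _ hu, zero_pow hq, sub_zero, eq_comm, mul_eq_zero, or_iff_right h2K,
      map_eq_zero] at h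
    exact h
  have hcard : Nat.card L = Fintype.card F ^ (2 * Module.finrank K C) := by
    have h1 : Nat.card L = Nat.card C :=
      Nat.card_congr ((Equiv.ofBijective _ hbij).subtypeEquiv hmem)
    rw [h1, Module.natCard_eq_pow_finrank (K := K), Nat.card_eq_fintype_card, hK, hF, pow_mul]
  refine hL.exists_isStabilizerCodeWithParams h2 (hn ▸ Fintype.card_ne_zero) hcard
    fun v hv0 hv => ?_
  rw [errorWeight_eq_hammingNorm_pairMap (e := e) hφ hq hσ hγ hγ0 h2]
  refine hd _ (fun c hc => ?_) fun h => hv0 (hbij.1 (h.trans (map_zero _).symm))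
  by_contra h0
  -- K-linearity enters here: c can be rescaled inside C so that its product with the error is γ
  -- σ(f). The symplectic form then equals f, whose trace is nonzero.
  obtain ⟨f, hf⟩ := exists_absTrace_mul_ne_zero (one_ne_zero (α := F))
  rw [one_mul] at hf
  obtain ⟨u, hu⟩ := hbij.2 ((γ * σ f / hermProd q c (pairMap σ γ e v)) • c)
  have hprod : hermProd q (pairMap σ γ e u) (pairMap σ γ e v) = γ * σ f := by
    rw [hu, hermProd]
    simp only [Pi.smul_apply, smul_eq_mul, mul_assoc, ← Finset.mul_sum]
    exact div_mul_cancel₀ _ h0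
  have h := hermProd_pairMap_sub_pow (e := e) hφ hσ hγ u v
  rw [hprod, mul_pow, hγ, hσ] at h
  have hfs : f = symp u v := σ.injective (mul_left_cancel₀ h2K (by rw [← h]; ring))
  exact hf (hfs ▸ hv u ((hmem u).mpr (hu ▸ C.smul_mem _ hc)))

end Hermitian

/-! ### Bilinearity of the Hermitian product -/

section HermProd

variable {K ι : Type*} [Field K] [Fintype ι] {q : ℕ}

/-- A code is Hermitian self-orthogonal as soon as a set of generators is. -/
theorem span_subset_hermDual [Fintype K] (hK : Fintype.card K = q ^ 2) {S : Set (ι → K)}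
    (h : ∀ x ∈ S, ∀ y ∈ S, hermProd q x y = 0) :
    (Submodule.span K S : Set (ι → K)) ⊆ hermDual q (Submodule.span K S) := by
  obtain ⟨φ, hφ⟩ := exists_ringHom_eq_pow hK
  have hprod : ∀ x y : ι → K, hermProd q x y = ∑ i, x i * φ (y i) := fun x y => by
    simp only [hermProd, hφ]
  simp only [hprod] at h
  intro y hy x hx
  rw [hprod]
  induction hx using Submodule.span_induction with
  | zero => simp
  | add x x' _ _ hx hx' => simp [add_mul, Finset.sum_add_distrib, hx, hx']
  | smul c x _ hx => simp [mul_assoc, ← Finset.mul_sum, hx]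
  | mem x hx =>
    induction hy using Submodule.span_induction with
    | zero => simp
    | add y y' _ _ hy hy' => simp [mul_add, Finset.sum_add_distrib, hy, hy']
    | smul c y _ hy => simp [mul_left_comm _ (φ c), ← Finset.mul_sum, hy]
    | mem y hy => exact h x hx y hy

end HermProd

/-! ### Alternating sums of powers of a root of unity -/

theorem sum_range_add_of_periodic {M : Type*} [AddCommGroup M] {g : ℕ → M} {N : ℕ}
    (hg : ∀ i, g (i + N) = g i) (c : ℕ) :
    ∑ i ∈ Finset.range N, g (i + c) = ∑ i ∈ Finset.range N, g i := by
  induction c with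
  | zero => rfl
  | succ c ih =>
    rw [← ih]
    -- Split off the first or the last of N + 1 consecutive terms; by periodicity these two terms
    -- are equal.
    have h := (Finset.sum_range_succ' (fun i => g (i + c)) N).symm.trans
      (Finset.sum_range_succ (fun i => g (i + c)) N)
    rw [add_comm N c, hg, zero_add] at h
    simpa only [add_assoc, add_comm 1 c] using add_right_cancel h

/-- The sign of the block of length `lam` that contains `i`: the norm of the twist vector. -/
def blockSign (K : Type*) [Field K] (lam i : ℕ) : K := if Even (i / lam) then -1 else 1

theorem blockSign_add {K : Type*} [Field K] {lam : ℕ} (hlam : 0 < lam) (i : ℕ) :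
    blockSign K lam (i + lam) = -blockSign K lam i := by
  rw [blockSign, blockSign, Nat.add_div_right _ hlam]
  by_cases h : Even (i / lam) <;> simp [h, Nat.even_add_one]

theorem blockSign_add_mul {K : Type*} [Field K] {lam : ℕ} (hlam : 0 < lam) (i t : ℕ) :
    blockSign K lam (i + lam * t) = (-1) ^ t * blockSign K lam i := by
  induction t with
  | zero => simp
  | succ t ih => rw [mul_add_one, ← add_assoc, blockSign_add hlam, ih, pow_succ]; ring

theorem sum_blockSign_mul_pow_eq_zero {K : Type*} [Field K] {lam t : ℕ} (hlam : 0 < lam)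
    (ht : Even t) {z : K} (hz : z ^ (lam * t) = 1) (hz1 : z ^ lam ≠ -1) :
    ∑ i ∈ Finset.range (lam * t), blockSign K lam i * z ^ i = 0 := by
  have hper : ∀ i, blockSign K lam (i + lam * t) * z ^ (i + lam * t) =
      blockSign K lam i * z ^ i := fun i => by
    rw [blockSign_add_mul hlam, ht.neg_one_pow, one_mul, pow_add, hz, mul_one]
  have h := sum_range_add_of_periodic (g := fun i => blockSign K lam i * z ^ i) hper lam
  have hshift : ∀ i, blockSign K lam (i + lam) * z ^ (i + lam) =
      -z ^ lam * (blockSign K lam i * z ^ i) := fun i => by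
    rw [blockSign_add hlam, pow_add]; ring
  simp only [hshift, ← Finset.mul_sum] at h
  have h' : (z ^ lam + 1) * ∑ i ∈ Finset.range (lam * t), blockSign K lam i * z ^ i = 0 := by
    linear_combination -h
  exact (mul_eq_zero.mp h').resolve_left fun h0 => hz1 (eq_neg_of_add_eq_zero_left h0)

theorem pow_half_eq_neg_one {K : Type*} [Field K] {β : K} {s : ℕ} (hs : 0 < s)
    (hβ : IsPrimitiveRoot β (s * 2)) : β ^ s = -1 :=
  (hβ.pow (by lia) rfl).eq_neg_one_of_two_right

/-- The exponent `e + q e'` does not hit `-1` when `e, e' ≤ (q - 1) / 2`. -/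
theorem pow_add_mul_ne_neg_one {K : Type*} [Field K] {β : K} {q : ℕ} (hodd : Odd q)
    (hβ : IsPrimitiveRoot β (q + 1)) {e e' : ℕ} (he : e ≤ (q - 1) / 2) (he' : e' ≤ (q - 1) / 2) :
    β ^ (e + q * e') ≠ -1 := by
  obtain ⟨s, rfl⟩ := hodd
  intro h
  have hhalf : β ^ (s + 1) = -1 :=
    pow_half_eq_neg_one (by lia) (by convert hβ using 1; ring)
  -- Multiply by β^e' and use β^(q+1) = 1. Both exponents are below q + 1 = 2s + 2, so they would
  -- coincide, although e ≤ s.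
  have h1 : β ^ e = β ^ (s + 1 + e') := by
    calc β ^ e = β ^ e * (β ^ (2 * s + 1 + 1)) ^ e' := by rw [hβ.pow_eq_one, one_pow, mul_one]
      _ = β ^ (e + (2 * s + 1) * e') * β ^ e' := by ring
      _ = β ^ (s + 1 + e') := by rw [h, pow_add β (s + 1), hhalf]
  have := hβ.pow_inj (by lia) (by lia) h1
  lia

/-! ### Evaluation codes on a grid -/

section Code

variable {K : Type*} [Field K] {m : ℕ} {a : Fin m → ℕ} {A : Fin m → Finset K}
  {ξ : ∀ j, Fin (a j) ≃ A j}

theorem ev_apply (v : Box a → K) (f : MvPolynomial (Fin m) K) (α : Box a) :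
    ev ξ v f α = v α * MvPolynomial.eval (point ξ α) f := rfl

theorem eval_mono (e α : Box a) :
    MvPolynomial.eval (point ξ α) (mono K e) = ∏ j, (ξ j (α j) : K) ^ (e j : ℕ) := by
  simp [mono, point]

theorem code_eq_span (v : Box a → K) (Δ : Finset (Box a)) :
    code ξ v Δ = Submodule.span K ((fun e => ev ξ v (mono K e)) '' (Δ : Set (Box a))) := by
  rw [code, monoSpace, Submodule.map_span, Set.image_image]

/-- The exponent of a monomial as a finitely supported function. -/
noncomputable def exponent (e : Box a) : Fin m →₀ ℕ := Finsupp.equivFunOnFinite.symm fun j => (e j : ℕ)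

theorem exponent_injective : Function.Injective (exponent (a := a)) := fun _ _ h =>
  funext fun j => Fin.ext (DFunLike.congr_fun h j)

theorem mono_eq_monomial (e : Box a) : mono K e = MvPolynomial.monomial (exponent e) 1 := by
  rw [MvPolynomial.monomial_eq, mono, map_one, one_mul, Finsupp.prod_fintype _ _ (by simp)]
  rfl

/-- Evaluations of reduced monomials at the points of a grid are linearly independent. -/
theorem linearIndependent_ev_mono {v : Box a → K} (hv : ∀ α, v α ≠ 0) :
    LinearIndependent K fun e : Box a => ev ξ v (mono K e) := by
  classical
  rw [Fintype.linearIndependent_iff]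
  intro c hc e
  let P : MvPolynomial (Fin m) K := ∑ e : Box a, MvPolynomial.monomial (exponent e) (c e)
  have hP : ev ξ v P = 0 := by
    rw [← hc, map_sum]
    refine Finset.sum_congr rfl fun e _ => ?_
    rw [← map_smul, mono_eq_monomial, MvPolynomial.smul_monomial, smul_eq_mul, mul_one]
  -- P has degree below |A j| in each variable, and it vanishes on the whole grid because v has no
  -- zero entry.
  have hP0 : P = 0 := by
    refine MvPolynomial.eq_zero_of_eval_zero_at_prod_finset P A (fun j => ?_) fun x hx => ?_
    · have hcard : (A j).card = a j := by
        rw [← Fintype.card_coe, ← Fintype.card_congr (ξ j), Fintype.card_fin]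
      rw [hcard, MvPolynomial.degreeOf_lt_iff (Fin.pos (e j))]
      intro s hs
      obtain ⟨e', -, he'⟩ := Finset.mem_biUnion.mp (MvPolynomial.support_sum hs)
      rw [Finset.mem_singleton.mp (MvPolynomial.support_monomial_subset he')]
      exact (e' j).2
    · have h := congrFun hP fun j => (ξ j).symm ⟨x j, hx j⟩
      rw [ev_apply, Pi.zero_apply, mul_eq_zero, or_iff_right (hv _)] at h
      have hpt : point ξ (fun j => (ξ j).symm ⟨x j, hx j⟩) = x := by
        funext j
        simp [point]
      rwa [hpt] at h
  have hcoeff := congrArg (MvPolynomial.coeff (exponent e)) hP0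
  simpa [P, MvPolynomial.coeff_sum, MvPolynomial.coeff_monomial, exponent_injective.eq_iff]
    using hcoeff

theorem finrank_code {v : Box a → K} (hv : ∀ α, v α ≠ 0) (Δ : Finset (Box a)) :
    Module.finrank K (code ξ v Δ) = Δ.card := by
  classical
  have hli := linearIndependent_ev_mono (ξ := ξ) hv
  rw [code_eq_span, ← Finset.coe_image, finrank_span_finset_eq_card,
    Finset.card_image_of_injective _ hli.injective]
  rw [Finset.coe_image]
  exact LinearIndepOn.id_image (hli.comp _ Subtype.val_injective)

/-- The Hermitian dual of a twisted code has minimum distance at least that of the Euclidean dual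
of the untwisted code. -/
theorem minDist_euclDual_le_hammingNorm [DecidableEq K] {q : ℕ} (hq : q ≠ 0) {v : Box a → K}
    (hv : ∀ α, v α ≠ 0) {Δ : Finset (Box a)} {y : Box a → K} (hy : y ∈ hermDual q (code ξ v Δ))
    (hy0 : y ≠ 0) :
    minDist (euclDual (code ξ (fun _ => 1) Δ) : Set (Box a → K)) ≤ hammingNorm y := by
  -- Chosen so that its Euclidean product with an untwisted evaluation of f is the Hermitian product
  -- of the twisted evaluation of f with y.
  let z : Box a → K := fun α => v α * y α ^ q
  have hz : ∀ α, z α = 0 ↔ y α = 0 := fun α => by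
    simp [z, hv α, hq]
  have hnorm : hammingNorm z = hammingNorm y := by
    simp only [hammingNorm, ne_eq, hz]
  rw [← hnorm]
  refine Nat.sInf_le ⟨z, ?_, 0, Submodule.zero_mem _, ?_, hammingDist_zero_right z⟩
  · rintro _ ⟨f, hf, rfl⟩
    rw [← hy _ ⟨f, hf, rfl⟩, dotProduct, hermProd]
    refine Finset.sum_congr rfl fun α _ => ?_
    rw [ev_apply, ev_apply]
    ring
  · exact fun h => hy0 (funext fun α => (hz α).mp (congrFun h α))

theorem twist_ne_zero [NeZero m] {q lam : ℕ} {η : K} (hη : η ≠ 0) (α : Box a) :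
    twist q lam η α ≠ 0 := by
  rw [twist]
  split_ifs
  · exact pow_ne_zero _ hη
  · exact one_ne_zero

theorem twist_mul_twist_pow [NeZero m] {q lam : ℕ} {η : K}
    (hη : η ^ ((q - 1) / 2 * (q + 1)) = -1) (α : Box a) :
    twist q lam η α * twist q lam η α ^ q = blockSign K lam (α 0) := by
  rw [← pow_succ', twist, blockSign]
  split_ifs
  · rw [← pow_mul, hη]
  · rw [one_pow]

/-- The twist depends on the first coordinate only, so the summand is a product of one-variable
functions and the sum over the grid factors. -/
theorem hermProd_ev_mono [NeZero m] {q lam : ℕ} {η : K}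
    (hη : η ^ ((q - 1) / 2 * (q + 1)) = -1) (e e' : Box a) :
    hermProd q (ev ξ (twist q lam η) (mono K e)) (ev ξ (twist q lam η) (mono K e')) =
      ∏ j, ∑ i : Fin (a j), (if j = 0 then blockSign K lam i else 1) *
        (ξ j i : K) ^ ((e j : ℕ) + q * e' j) := by
  rw [Finset.prod_univ_sum, Fintype.piFinset_univ, hermProd]
  refine Finset.sum_congr rfl fun α _ => ?_
  rw [Finset.prod_mul_distrib, Finset.prod_ite_eq' Finset.univ 0 fun j => blockSign K lam (α j),
    if_pos (Finset.mem_univ _)]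
  rw [ev_apply, ev_apply, mul_pow, mul_mul_mul_comm, twist_mul_twist_pow hη, eval_mono, eval_mono,
    ← Finset.prod_pow, ← Finset.prod_mul_distrib]
  refine congrArg _ (Finset.prod_congr rfl fun j _ => ?_)
  rw [pow_add, mul_comm q, pow_mul]

/-- Twisted codes supported on exponents with small first entry are Hermitian self-orthogonal. -/
theorem code_twist_subset_hermDual [Fintype K] [NeZero m] {q lam : ℕ}
    (hK : Fintype.card K = q ^ 2) (hodd : Odd q) (hlam : 0 < lam) (ha0 : a 0 = lam * (q + 1))
    {ζ η : K} (hζ : IsPrimitiveRoot ζ (lam * (q + 1))) (hη : η ^ ((q - 1) / 2 * (q + 1)) = -1)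
    (hξ0 : ∀ i : Fin (a 0), (ξ 0 i : K) = ζ ^ (i : ℕ))
    {Δ : Finset (Box a)} (hΔ : ∀ e ∈ Δ, (e 0 : ℕ) ≤ (q - 1) / 2) :
    (code ξ (twist q lam η) Δ : Set (Box a → K)) ⊆ hermDual q (code ξ (twist q lam η) Δ) := by
  rw [code_eq_span]
  refine span_subset_hermDual hK ?_
  rintro _ ⟨e, he, rfl⟩ _ ⟨e', he', rfl⟩
  rw [hermProd_ev_mono hη]
  refine Finset.prod_eq_zero (Finset.mem_univ 0) ?_
  set k := (e 0 : ℕ) + q * e' 0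
  have hterm : ∀ i : Fin (a 0), (if (0 : Fin m) = 0 then blockSign K lam i else 1) *
      (ξ 0 i : K) ^ k = blockSign K lam i * (ζ ^ k) ^ (i : ℕ) := fun i => by
    rw [if_pos rfl, hξ0, pow_right_comm]
  rw [Finset.sum_congr rfl fun i _ => hterm i,
    Fin.sum_univ_eq_sum_range fun i => blockSign K lam i * (ζ ^ k) ^ i, ha0]
  refine sum_blockSign_mul_pow_eq_zero hlam hodd.add_one ?_ ?_
  · rw [pow_right_comm, hζ.pow_eq_one, one_pow]
  · rw [pow_right_comm]
    exact pow_add_mul_ne_neg_one hodd (hζ.pow (by positivity) rfl) (hΔ e he) (hΔ e' he')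

end Code

end GMCC

theorem theorem3p5
    (q : ℕ) (hq : IsPrimePow q) (hodd : Odd q)
    {F : Type*} [Field F] [Fintype F] [DecidableEq F] (hF : Fintype.card F = q)
    {K : Type*} [Field K] [Fintype K] [DecidableEq K] (hK : Fintype.card K = q ^ 2)
    (m : ℕ) [NeZero m] (lam : ℕ) (hlam : lam ∣ q - 1)
    (a : Fin m → ℕ) (ha0 : a 0 = lam * (q + 1)) (ha : ∀ j, j ≠ 0 → 2 ≤ a j)
    (ζ : K) (hζ : IsPrimitiveRoot ζ (lam * (q + 1)))
    (η : K) (hη : IsPrimitiveRoot η (q ^ 2 - 1))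
    (A : Fin m → Finset K)
    (hA0 : ∀ x : K, x ∈ A 0 ↔ x ^ (lam * (q + 1)) = 1)
    (hA : ∀ j, j ≠ 0 → (0 : K) ∉ A j)
    (ξ : ∀ j, Fin (a j) ≃ A j)
    (hξ0 : ∀ i : Fin (a 0), (ξ 0 i : K) = ζ ^ (i : ℕ))
    (Δ : Finset (GMCC.Box a)) (hΔ : ∀ e ∈ Δ, (e 0 : ℕ) ≤ (q - 1) / 2) :
    (GMCC.code ξ (GMCC.twist q lam η) Δ : Set (GMCC.Box a → K)) ⊆
        GMCC.hermDual q (GMCC.code ξ (GMCC.twist q lam η) Δ) ∧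
      ∃ k : ℕ, k + 2 * Δ.card = ∏ j, a j ∧
        ∃ D : ℕ,
          GMCC.minDist (GMCC.euclDual (GMCC.code ξ (fun _ => 1) Δ) : Set (GMCC.Box a → K)) ≤ D ∧
          ∃ Q : Submodule ℂ (GMCC.State F (∏ j, a j)), GMCC.IsStabilizerCodeWithParams Q k D := by
  have hq1 : 1 < q := hq.one_lt
  have hlam0 : 0 < lam := Nat.pos_of_dvd_of_pos hlam (by lia)
  obtain ⟨s, rfl⟩ := hodd
  have hodd : Odd (2 * s + 1) := ⟨s, rfl⟩
  have hs : 0 < s := by lia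
  have horder : (2 * s + 1) ^ 2 - 1 = s * (2 * s + 1 + 1) * 2 := by
    rw [Nat.sub_eq_iff_eq_add (Nat.one_le_pow _ _ (by lia))]
    ring
  rw [horder] at hη
  have hη0 : η ≠ 0 := hη.ne_zero (by positivity)
  have hhalf : η ^ (s * (2 * s + 1 + 1)) = -1 := GMCC.pow_half_eq_neg_one (by positivity) hη
  have hsub : (2 * s + 1 - 1) / 2 = s := by lia
  have hC := GMCC.code_twist_subset_hermDual (ξ := ξ) hK hodd hlam0 ha0 hζ (by rw [hsub, hhalf]) hξ0 hΔ
  -- Take γ = η^((q+1)/2): then γ^(q-1) = η^((q²-1)/2) = -1.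
  have hγ : (η ^ (s + 1)) ^ (2 * s + 1) = -η ^ (s + 1) := by
    calc (η ^ (s + 1)) ^ (2 * s + 1) = η ^ (s * (2 * s + 1 + 1)) * η ^ (s + 1) := by ring
      _ = -η ^ (s + 1) := by rw [hhalf, neg_one_mul]
  have : Nonempty (GMCC.Box a) := by
    refine ⟨fun j => ⟨0, ?_⟩⟩
    by_cases hj : j = 0
    · rw [hj, ha0]
      positivity
    · exact two_pos.trans_le (ha j hj)
  have htwist := GMCC.twist_ne_zero (a := a) (q := 2 * s + 1) (lam := lam) hη0
  refine ⟨hC, ?_⟩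
  rw [← GMCC.finrank_code (ξ := ξ) htwist Δ]
  exact GMCC.exists_isStabilizerCodeWithParams_of_subset_hermDual hF hK hodd hγ
    (pow_ne_zero _ hη0) (by simp) hC
    fun y hy hy0 => GMCC.minDist_euclDual_le_hammingNorm (by lia) htwist hy hy0
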